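/- Let $G$ be a partially ordered abelian group (a translation-invariant partial order) that is - *simple*: every $u>0$ in $G$ is an order-unit, i.e. for every $x\in G$ there is an integer $n\ge 1$ with $x\le nu$; and - *unperforated*: for all integers $n\ge 1$ and all $x\in G$, $nx\ge 0$ implies $x\ge 0$. Then there exist a nonzero partially ordered abelian group $H$ and an injective group homomorphism $f:G\to H$ satisfying $f(x)\le f(y)\Leftrightarrow x\le y$ for all $x,y\in G$, such that $H$ is simple, is divisible (for all $n\ge1$ and $x\in H$ there is $y\in H$ with $ny=x$), and is a dimension group: $H$ is unperforated, is directed (any two elements have a common upper bound), and has the interpolation property (whenever $x_1,x_2\le y_1,y_2$ in $H$, there is $z\in H$ with $x_1,x_2\le z\le y_1,y_2$). -/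

import Mathlib

universe u

section PartiallyOrderedAbelianGroups

variable (G : Type*) [AddCommGroup G] [PartialOrder G]

/-- An order-unit of a partially ordered abelian group: a positive element whose positive
multiples dominate every element of the group. -/
def IsOrderUnit {G : Type*} [AddCommGroup G] [PartialOrder G] (u : G) : Prop :=
  0 ≤ u ∧ ∀ x : G, ∃ n : ℕ, 0 < n ∧ x ≤ n • u

/-- Every strictly positive element is an order-unit. (Equivalently, the only directed convex
subgroups are the zero subgroup and possibly the whole group.) -/
def IsSimplePOGroup : Prop :=
  ∀ u : G, 0 < u → IsOrderUnit u

/-- Unperforated: a positive multiple of `x` is positive only if `x` is. -/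
def IsUnperforated : Prop :=
  ∀ (n : ℕ) (x : G), 0 < n → 0 ≤ n • x → 0 ≤ x

/-- The Riesz interpolation property. -/
def HasInterpolation : Prop :=
  ∀ x₁ x₂ y₁ y₂ : G, x₁ ≤ y₁ → x₁ ≤ y₂ → x₂ ≤ y₁ → x₂ ≤ y₂ →
    ∃ z : G, x₁ ≤ z ∧ x₂ ≤ z ∧ z ≤ y₁ ∧ z ≤ y₂

/-- A Riesz group is an upward directed interpolation group. -/
structure IsRieszGroup : Prop where
  directed : ∀ x y : G, ∃ z : G, x ≤ z ∧ y ≤ z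
  interpolation : HasInterpolation G

/-- A dimension group is an unperforated Riesz group. -/
structure IsDimensionGroup : Prop extends IsRieszGroup G where
  unperforated : IsUnperforated G

/-- A divisible abelian group. -/
def IsDivisibleGroup (G : Type*) [AddCommGroup G] : Prop :=
  ∀ (n : ℕ) (x : G), 0 < n → ∃ y : G, n • y = x

end PartiallyOrderedAbelianGroups

/-! Fix `u > 0`. The states at `u` detect the strict order: if `x > 0`, simplicity gives `u ≤ n •
x`, so every state is at least `1 / n` at `x`; if not `0 < x`, Hahn–Banach for the upper gauge of
`u` gives a state that is nonpositive at `x` (`IsOrderUnit.exists_state_nonpos`). Hence evaluation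
on states sends `G` into bounded functions ordered by uniform strict positivity, and needs no
compactness. States may fail to separate points, so a second coordinate in the divisible hull
restores injectivity without affecting strict inequalities. The target `FunInfinitesimal`
interpolates because strict inequalities leave a uniform gap. -/

/-! ### Additive minorants of sublinear functions -/

/-- A real-valued function on an abelian group that is subadditive and (super)homogeneous for
natural multiples. -/
structure IsSublinear {G : Type*} [AddCommGroup G] (p : G → ℝ) : Prop where
  add_le : ∀ x y, p (x + y) ≤ p x + p y
  le_nsmul : ∀ (k : ℕ) (x : G), k * p x ≤ p (k • x)

namespace IsSublinear

variable {G : Type*} [AddCommGroup G] {p : G → ℝ}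

theorem map_zero (hp : IsSublinear p) : p 0 = 0 := by
  have h1 := hp.add_le 0 0
  have h2 := hp.le_nsmul 2 0
  simp only [add_zero, smul_zero, Nat.cast_ofNat] at h1 h2
  linarith

theorem nsmul_le (hp : IsSublinear p) (k : ℕ) (x : G) : p (k • x) ≤ k * p x := by
  induction k with
  | zero => simp [hp.map_zero]
  | succ k ih =>
    have := hp.add_le (k • x) x
    rw [succ_nsmul]
    push_cast
    linarith

theorem neg_le (hp : IsSublinear p) (x : G) : -p (-x) ≤ p x := by
  have := hp.add_le x (-x)
  rw [add_neg_cancel, hp.map_zero] at this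
  linarith

/-- The directional regularization of a sublinear function along `y`. -/
noncomputable def regularize (p : G → ℝ) (y x : G) : ℝ :=
  ⨅ n : ℕ, (p (x + n • y) - n * p y)

theorem bddBelow_regularize (hp : IsSublinear p) (y x : G) :
    BddBelow (Set.range fun n : ℕ => p (x + n • y) - n * p y) := by
  refine ⟨-p (-x), ?_⟩
  rintro _ ⟨n, rfl⟩
  have h1 := hp.add_le (x + n • y) (-x)
  have h2 := hp.le_nsmul n y
  rw [add_neg_cancel_comm] at h1
  simp only
  linarith

theorem regularize_le_sub (hp : IsSublinear p) (y x : G) (n : ℕ) :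
    regularize p y x ≤ p (x + n • y) - n * p y :=
  ciInf_le (hp.bddBelow_regularize y x) n

theorem regularize_le (hp : IsSublinear p) (y x : G) : regularize p y x ≤ p x := by
  simpa using hp.regularize_le_sub y x 0

/-- This is the point of regularizing: any sublinear minorant of `regularize p y` must equal `p` at
`y`. -/
theorem regularize_neg_le (hp : IsSublinear p) (y : G) : regularize p y (-y) ≤ -p y := by
  simpa [hp.map_zero] using hp.regularize_le_sub y (-y) 1

theorem isSublinear_regularize (hp : IsSublinear p) (y : G) : IsSublinear (regularize p y) where
  add_le x z := by
    have key : ∀ m n : ℕ, regularize p y (x + z) ≤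
        (p (x + m • y) - m * p y) + (p (z + n • y) - n * p y) := fun m n => by
      have h1 := hp.regularize_le_sub y (x + z) (m + n)
      have h2 := hp.add_le (x + m • y) (z + n • y)
      rw [show x + m • y + (z + n • y) = x + z + (m + n) • y by rw [add_nsmul]; abel] at h2
      push_cast at h1
      linarith
    have h1 : ∀ m : ℕ, regularize p y (x + z) - (p (x + m • y) - m * p y) ≤
        regularize p y z := fun m => le_ciInf fun n => by linarith [key m n]
    have h2 : regularize p y (x + z) - regularize p y z ≤ regularize p y x :=
      le_ciInf fun m => by linarith [h1 m]
    linarith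
  le_nsmul k x := le_ciInf fun n => by
    rcases Nat.eq_zero_or_pos k with rfl | hk
    · have := hp.le_nsmul n y
      simpa using this
    · have hk' : (1 : ℝ) ≤ k := by exact_mod_cast hk
      have h1 := mul_le_mul_of_nonneg_left (hp.regularize_le_sub y x n) (zero_le_one.trans hk')
      have h2 := hp.le_nsmul k (x + n • y)
      -- Pad `n • y` to `(k * n) • y`, making the argument a multiple of `k`; the padding costs at
      -- most `(k - 1) * n * p y`.
      have h3 := hp.add_le (k • x + n • y) (((k - 1) * n) • y)
      have h4 := hp.nsmul_le ((k - 1) * n) y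
      have h5 : k • x + n • y + ((k - 1) * n) • y = k • (x + n • y) := by
        obtain ⟨j, rfl⟩ := Nat.exists_eq_add_of_le' hk
        rw [Nat.add_sub_cancel, smul_add, add_assoc, ← add_nsmul, smul_smul]
        congr 2
        ring
      rw [h5] at h3
      push_cast [Nat.cast_sub hk] at h4
      linarith

theorem exists_minimal_le (hp : IsSublinear p) :
    ∃ q ≤ p, Minimal (fun r : G → ℝ => IsSublinear r) q := by
  -- In the order dual, a chain is bounded by its pointwise infimum, which is finite by `neg_le`.
  refine @zorn_le_nonempty₀ (G → ℝ)ᵒᵈ _ {r | IsSublinear (G := G) r} ?_ p hp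
  intro c hcs hc r₀ hr₀
  have hc' : ∀ r ∈ c, ∀ s ∈ c, (∀ x, r x ≤ s x) ∨ ∀ x, s x ≤ r x := fun r hr s hs =>
    (hc.total hr hs).symm
  have hsub : ∀ r ∈ c, IsSublinear (G := G) r := hcs
  have : Nonempty c := ⟨⟨r₀, hr₀⟩⟩
  have hbdd : ∀ x, BddBelow (Set.range fun r : c => (r.1 : G → ℝ) x) := by
    intro x
    refine ⟨-(r₀ : G → ℝ) (-x), ?_⟩
    rintro _ ⟨⟨r, hr⟩, rfl⟩
    rcases hc' r hr r₀ hr₀ with h | h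
    · exact (neg_le_neg (h (-x))).trans ((hsub r hr).neg_le x)
    · exact ((hsub r₀ hr₀).neg_le x).trans (h x)
  have hle : ∀ r (hr : r ∈ c) x, (⨅ r : c, (r.1 : G → ℝ) x) ≤ r x := fun r hr x =>
    ciInf_le (hbdd x) ⟨r, hr⟩
  refine ⟨fun x => ⨅ r : c, (r.1 : G → ℝ) x, ⟨fun x y => ?_, fun k x => ?_⟩, hle⟩
  · have key : ∀ r s : c, (⨅ r : c, (r.1 : G → ℝ) (x + y)) ≤
        (r.1 : G → ℝ) x + (s.1 : G → ℝ) y := by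
      rintro ⟨r, hr⟩ ⟨s, hs⟩
      rcases hc' r hr s hs with h | h
      · have h1 := (hsub r hr).add_le x y
        linarith [hle r hr (x + y), h y]
      · have h1 := (hsub s hs).add_le x y
        linarith [hle s hs (x + y), h x]
    have h1 : ∀ r : c, (⨅ r : c, (r.1 : G → ℝ) (x + y)) - (r.1 : G → ℝ) x ≤
        ⨅ s : c, (s.1 : G → ℝ) y := fun r => le_ciInf fun s => by linarith [key r s]
    have h2 : (⨅ r : c, (r.1 : G → ℝ) (x + y)) - (⨅ s : c, (s.1 : G → ℝ) y) ≤
        ⨅ r : c, (r.1 : G → ℝ) x := le_ciInf fun r => by linarith [h1 r]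
    linarith
  · refine le_ciInf fun r => ?_
    exact (mul_le_mul_of_nonneg_left (hle r.1 r.2 x) (Nat.cast_nonneg k)).trans
      ((hsub r.1 r.2).le_nsmul k x)

/-- By minimality `p` is its own regularization along `x`. Oddness then turns subadditivity into
additivity. -/
theorem map_neg_of_minimal (hp : Minimal (fun r : G → ℝ => IsSublinear r) p) (x : G) :
    p (-x) = -p x := by
  have h1 := hp.le_of_le (hp.prop.isSublinear_regularize x) (hp.prop.regularize_le x) (-x)
  have h2 := hp.prop.regularize_neg_le x
  have h3 := hp.prop.neg_le x
  linarith

/-- **Hahn–Banach for abelian groups**: a sublinear function dominates an additive function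
agreeing with it at a given point. -/
theorem exists_addMonoidHom (hp : IsSublinear p) (y : G) :
    ∃ f : G →+ ℝ, (∀ x, f x ≤ p x) ∧ f y = p y := by
  obtain ⟨q, hq, hmin⟩ := (hp.isSublinear_regularize y).exists_minimal_le
  have hneg := map_neg_of_minimal hmin
  refine ⟨AddMonoidHom.mk' q fun a b => le_antisymm (hmin.prop.add_le a b) ?_,
    fun x => (hq x).trans (hp.regularize_le y x), ?_⟩
  · have h := hmin.prop.add_le (-a) (-b)
    rw [← neg_add, hneg, hneg, hneg] at h
    linarith
  · have h1 := (hq (-y)).trans (hp.regularize_neg_le y)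
    have h2 := (hq y).trans (hp.regularize_le y y)
    rw [hneg] at h1
    exact le_antisymm h2 (neg_le_neg_iff.mp h1)

end IsSublinear

/-! ### States on unperforated groups with an order-unit -/

section States

variable {G : Type*} [AddCommGroup G] [PartialOrder G]

/-- A state on `(G, u)`: a positive homomorphism to `ℝ` normalized at `u`. -/
def IsState (u : G) (f : G →+ ℝ) : Prop :=
  (∀ x, 0 ≤ x → 0 ≤ f x) ∧ f u = 1

/-- Rational upper bounds `m / n` for `x` relative to `u`. -/
def upperRatios (u x : G) : Set ℝ :=
  {q | ∃ (n : ℕ) (m : ℤ), 0 < n ∧ n • x ≤ m • u ∧ q = m / n}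

/-- The upper gauge of an order-unit. -/
noncomputable def upperGauge (u x : G) : ℝ := sInf (upperRatios u x)

theorem IsOrderUnit.nonempty_upperRatios {u : G} (hu : IsOrderUnit u) (x : G) :
    (upperRatios u x).Nonempty := by
  obtain ⟨n, -, hn⟩ := hu.2 x
  exact ⟨n, 1, n, one_pos, by simpa using hn, by simp⟩

variable [IsOrderedAddMonoid G] {u : G}

theorem nonneg_of_zsmul_nonneg (hu : 0 < u) {m : ℤ} (h : 0 ≤ m • u) : 0 ≤ m := by
  by_contra hm
  have h1 : (0 : G) < (-m) • u := zsmul_pos hu (by omega)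
  rw [neg_zsmul] at h1
  exact absurd h (not_le_of_gt (neg_pos.mp h1))

theorem IsOrderUnit.bddBelow_upperRatios (hu : IsOrderUnit u) (hpos : 0 < u) (x : G) :
    BddBelow (upperRatios u x) := by
  obtain ⟨k, -, hk⟩ := hu.2 (-x)
  refine ⟨-k, ?_⟩
  rintro _ ⟨n, m, hn, h, rfl⟩
  have h1 : (0 : G) ≤ (m + n * k : ℤ) • u := by
    have h2 := add_le_add h (nsmul_le_nsmul_right hk n)
    rw [smul_neg, add_neg_cancel] at h2
    rwa [add_zsmul, mul_zsmul, natCast_zsmul, natCast_zsmul]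
  have h2 : (0 : ℝ) ≤ m + n * k := by exact_mod_cast nonneg_of_zsmul_nonneg hpos h1
  rw [le_div_iff₀ (by exact_mod_cast hn)]
  linarith

theorem IsOrderUnit.upperGauge_le (hu : IsOrderUnit u) (hpos : 0 < u) {x : G} {n : ℕ} {m : ℤ}
    (hn : 0 < n) (h : n • x ≤ m • u) : upperGauge u x ≤ m / n :=
  csInf_le (hu.bddBelow_upperRatios hpos x) ⟨n, m, hn, h, rfl⟩

theorem IsOrderUnit.isSublinear_upperGauge (hu : IsOrderUnit u) (hpos : 0 < u) :
    IsSublinear (upperGauge u) where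
  add_le x y := by
    have key : ∀ a ∈ upperRatios u x, ∀ b ∈ upperRatios u y,
        upperGauge u (x + y) ≤ a + b := by
      rintro _ ⟨n, m, hn, h, rfl⟩ _ ⟨n', m', hn', h', rfl⟩
      have h1 : (n * n') • (x + y) ≤ (n' * m + n * m' : ℤ) • u := by
        have h2 := add_le_add (nsmul_le_nsmul_right h n') (nsmul_le_nsmul_right h' n)
        rw [add_zsmul, mul_zsmul, mul_zsmul, natCast_zsmul, natCast_zsmul]
        rwa [smul_add, mul_smul n n' y, mul_comm n n', mul_smul n' n x]
      refine (hu.upperGauge_le hpos (Nat.mul_pos hn hn') h1).trans (le_of_eq ?_)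
      have hn0 : (n : ℝ) ≠ 0 := by exact_mod_cast hn.ne'
      have hn0' : (n' : ℝ) ≠ 0 := by exact_mod_cast hn'.ne'
      push_cast
      field_simp
    have h1 : ∀ a ∈ upperRatios u x, upperGauge u (x + y) - a ≤ upperGauge u y :=
      fun a ha => le_csInf (hu.nonempty_upperRatios y) fun b hb => by linarith [key a ha b hb]
    have h2 : upperGauge u (x + y) - upperGauge u y ≤ upperGauge u x :=
      le_csInf (hu.nonempty_upperRatios x) fun a ha => by linarith [h1 a ha]
    linarith
  le_nsmul k x := by
    refine le_csInf (hu.nonempty_upperRatios _) ?_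
    rintro _ ⟨n, m, hn, h, rfl⟩
    have hn' : (0 : ℝ) < n := by exact_mod_cast hn
    rcases Nat.eq_zero_or_pos k with rfl | hk
    · rw [zero_smul, smul_zero] at h
      have : (0 : ℝ) ≤ m := by exact_mod_cast nonneg_of_zsmul_nonneg hpos h
      rw [Nat.cast_zero, zero_mul]
      positivity
    · have hk' : (0 : ℝ) < k := by exact_mod_cast hk
      rw [smul_smul] at h
      have h1 := hu.upperGauge_le hpos (Nat.mul_pos hn hk) h
      push_cast at h1
      calc k * upperGauge u x ≤ k * (m / (n * k)) := by gcongr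
        _ = m / n := by field_simp

/-- In an unperforated group, an element which is not strictly positive takes a nonpositive value
at some state. -/
theorem IsOrderUnit.exists_state_nonpos (hG : IsUnperforated G) (hu : IsOrderUnit u)
    (hpos : 0 < u) {x : G} (hx : ¬ 0 < x) : ∃ f : G →+ ℝ, IsState u f ∧ f x ≤ 0 := by
  -- Since `f (-x)` equals the gauge of `-x`, it remains to see that this gauge is nonnegative: a
  -- negative ratio would make some `n • x` strictly positive.
  obtain ⟨f, hf, hfx⟩ := (hu.isSublinear_upperGauge hpos).exists_addMonoidHom (-x)
  refine ⟨f, ⟨fun y hy => ?_, le_antisymm ?_ ?_⟩, ?_⟩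
  · have h := (hf (-y)).trans (hu.upperGauge_le hpos (n := 1) (m := 0) one_pos (by simpa using hy))
    simpa using h
  · have h := (hf u).trans (hu.upperGauge_le hpos (n := 1) (m := 1) one_pos (by simp))
    simpa using h
  · have h := (hf (-u)).trans (hu.upperGauge_le hpos (n := 1) (m := -1) one_pos (by simp))
    simpa using h
  · have h : 0 ≤ upperGauge u (-x) := by
      refine le_csInf (hu.nonempty_upperRatios _) ?_
      rintro _ ⟨n, m, hn, h, rfl⟩
      by_contra hlt
      have hn' : (0 : ℝ) < n := by exact_mod_cast hn
      have hm : m < 0 := by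
        by_contra hm
        have : (0 : ℝ) ≤ m := by exact_mod_cast not_lt.mp hm
        exact hlt (by positivity)
      have h1 : (0 : G) < n • x := by
        have h2 : (0 : G) < (-m) • u := zsmul_pos hpos (by omega)
        rw [neg_zsmul] at h2
        rw [smul_neg] at h
        exact h2.trans_le (neg_le.mp h)
      refine hx (lt_of_le_of_ne (hG n x hn h1.le) ?_)
      rintro rfl
      simp at h1
    rw [← hfx, map_neg] at h
    linarith

end States

/-! ### Lexicographic extension of a function space by infinitesimals -/

open BoundedContinuousFunction

/-- The group of pairs `(f, v)` with `f` a bounded continuous real function and `v` in a rational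
vector space of infinitesimals; `(f, v)` is strictly positive when `f` is uniformly strictly
positive. -/
def FunInfinitesimal (S V : Type*) [TopologicalSpace S] : Type _ := (S →ᵇ ℝ) × V

namespace FunInfinitesimal

variable {S V : Type*} [TopologicalSpace S]

@[ext]
theorem ext {a b : FunInfinitesimal S V} (h₁ : ∀ s, a.1 s = b.1 s) (h₂ : a.2 = b.2) : a = b :=
  Prod.ext (BoundedContinuousFunction.ext h₁) h₂

/-- `b - a` is uniformly strictly positive. -/
def StrictBelow (a b : FunInfinitesimal S V) : Prop :=
  ∃ ε > (0 : ℝ), ∀ s, a.1 s + ε ≤ b.1 s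

theorem StrictBelow.trans {a b c : FunInfinitesimal S V} (hab : StrictBelow a b)
    (hbc : StrictBelow b c) : StrictBelow a c := by
  obtain ⟨ε, hε, h⟩ := hab
  obtain ⟨δ, hδ, h'⟩ := hbc
  exact ⟨ε, hε, fun s => by linarith [h s, h' s]⟩

theorem StrictBelow.irrefl [Nonempty S] (a : FunInfinitesimal S V) : ¬ StrictBelow a a := by
  rintro ⟨ε, hε, h⟩
  linarith [h (Classical.arbitrary S)]

theorem exists_between_pairs {x₁ x₂ y₁ y₂ : FunInfinitesimal S V} (h₁₁ : StrictBelow x₁ y₁)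
    (h₁₂ : StrictBelow x₁ y₂) (h₂₁ : StrictBelow x₂ y₁) (h₂₂ : StrictBelow x₂ y₂) :
    ∃ z, StrictBelow x₁ z ∧ StrictBelow x₂ z ∧ StrictBelow z y₁ ∧ StrictBelow z y₂ := by
  obtain ⟨a, ha, h₁₁⟩ := h₁₁
  obtain ⟨b, hb, h₁₂⟩ := h₁₂
  obtain ⟨c, hc, h₂₁⟩ := h₂₁
  obtain ⟨d, hd, h₂₂⟩ := h₂₂
  obtain ⟨ε, hε, hεa, hεb, hεc, hεd⟩ : ∃ ε > 0, ε ≤ a ∧ ε ≤ b ∧ ε ≤ c ∧ ε ≤ d :=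
    ⟨min (min a b) (min c d), by positivity, by simp, by simp, by simp, by simp⟩
  -- Half the common gap goes on each side; the second coordinate is arbitrary.
  refine ⟨(((x₁.1 ⊔ x₂.1) + BoundedContinuousFunction.const S (ε / 2)), x₁.2),
    ⟨ε / 2, by positivity, fun s => ?_⟩, ⟨ε / 2, by positivity, fun s => ?_⟩,
    ⟨ε / 2, by positivity, fun s => ?_⟩, ⟨ε / 2, by positivity, fun s => ?_⟩⟩
  all_goals
    simp only [BoundedContinuousFunction.add_apply, BoundedContinuousFunction.coe_sup,
      Pi.sup_apply, BoundedContinuousFunction.const_apply]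
    have := h₁₁ s
    have := h₁₂ s
    have := h₂₁ s
    have := h₂₂ s
    rcases max_cases (x₁.1 s) (x₂.1 s) with ⟨h, h'⟩ | ⟨h, h'⟩ <;> rw [h] <;> linarith

section Group

variable [AddCommGroup V]

noncomputable instance : AddCommGroup (FunInfinitesimal S V) :=
  inferInstanceAs (AddCommGroup ((S →ᵇ ℝ) × V))

noncomputable instance [Module ℚ V] : Module ℚ (FunInfinitesimal S V) :=
  inferInstanceAs (Module ℚ ((S →ᵇ ℝ) × V))

@[simp] theorem add_fst_apply (a b : FunInfinitesimal S V) (s : S) :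
    (a + b).1 s = a.1 s + b.1 s := rfl

@[simp] theorem nsmul_fst_apply (n : ℕ) (a : FunInfinitesimal S V) (s : S) :
    (n • a).1 s = n * a.1 s := by
  rw [← nsmul_eq_mul]
  rfl

@[simp] theorem zero_fst_apply (s : S) : (0 : FunInfinitesimal S V).1 s = 0 := rfl

end Group

variable [Nonempty S]

instance : PartialOrder (FunInfinitesimal S V) where
  le a b := a = b ∨ StrictBelow a b
  le_refl a := Or.inl rfl
  le_trans := by
    rintro a b c (rfl | hab) (rfl | hbc)
    exacts [Or.inl rfl, Or.inr hbc, Or.inr hab, Or.inr (hab.trans hbc)]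
  le_antisymm := by
    rintro a b (rfl | hab) (hba | hba)
    exacts [rfl, rfl, hba.symm, absurd (hab.trans hba) (StrictBelow.irrefl a)]

theorem le_def {a b : FunInfinitesimal S V} : a ≤ b ↔ a = b ∨ StrictBelow a b := Iff.rfl

theorem lt_iff {a b : FunInfinitesimal S V} : a < b ↔ StrictBelow a b := by
  rw [lt_iff_le_and_ne, le_def]
  constructor
  · rintro ⟨rfl | h, hne⟩
    exacts [absurd rfl hne, h]
  · refine fun h => ⟨Or.inr h, ?_⟩
    rintro rfl
    exact StrictBelow.irrefl a h

theorem hasInterpolation : HasInterpolation (FunInfinitesimal S V) := by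
  intro x₁ x₂ y₁ y₂ h₁₁ h₁₂ h₂₁ h₂₂
  rcases h₁₁.eq_or_lt with rfl | l₁₁
  · exact ⟨x₁, le_rfl, h₂₁, le_rfl, h₁₂⟩
  rcases h₁₂.eq_or_lt with rfl | l₁₂
  · exact ⟨x₁, le_rfl, h₂₂, h₁₁, le_rfl⟩
  rcases h₂₁.eq_or_lt with rfl | l₂₁
  · exact ⟨x₂, h₁₁, le_rfl, le_rfl, h₂₂⟩
  rcases h₂₂.eq_or_lt with rfl | l₂₂
  · exact ⟨x₂, h₁₂, le_rfl, h₂₁, le_rfl⟩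
  obtain ⟨z, h₁, h₂, h₃, h₄⟩ := exists_between_pairs (lt_iff.mp l₁₁) (lt_iff.mp l₁₂)
    (lt_iff.mp l₂₁) (lt_iff.mp l₂₂)
  exact ⟨z, Or.inr h₁, Or.inr h₂, Or.inr h₃, Or.inr h₄⟩

variable [AddCommGroup V]

instance : IsOrderedAddMonoid (FunInfinitesimal S V) where
  add_le_add_left := by
    rintro a b (rfl | ⟨ε, hε, h⟩) c
    · exact le_rfl
    · exact Or.inr ⟨ε, hε, fun s => by simp only [add_fst_apply]; linarith [h s]⟩

instance : Nontrivial (FunInfinitesimal S V) where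
  exists_pair_ne := by
    refine ⟨0, ((BoundedContinuousFunction.const S (1 : ℝ)), (0 : V)), fun h => ?_⟩
    have := congrArg (fun a : FunInfinitesimal S V => a.1 (Classical.arbitrary S)) h
    simp at this

theorem isSimplePOGroup : IsSimplePOGroup (FunInfinitesimal S V) := by
  intro u hu
  refine ⟨hu.le, fun x => ?_⟩
  obtain ⟨ε, hε, h⟩ := lt_iff.mp hu
  -- The extra `1` supplies the uniform gap between `x` and `n • u`.
  obtain ⟨n, hn⟩ := exists_nat_gt ((‖x.1‖ + 1) / ε)
  have hn0 : 0 < n := by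
    have : (0 : ℝ) < n := lt_of_le_of_lt (by positivity) hn
    exact_mod_cast this
  refine ⟨n, hn0, Or.inr ⟨1, one_pos, fun s => ?_⟩⟩
  rw [div_lt_iff₀ hε] at hn
  have h1 := (le_abs_self _).trans (x.1.norm_coe_le_norm s)
  have h2 : (n : ℝ) * ε ≤ n * u.1 s := by
    have := h s
    rw [zero_fst_apply, zero_add] at this
    gcongr
  rw [nsmul_fst_apply]
  linarith

theorem isDivisibleGroup_of_module (H : Type*) [AddCommGroup H] [Module ℚ H] :
    IsDivisibleGroup H := by
  intro n x hn
  refine ⟨(n : ℚ)⁻¹ • x, ?_⟩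
  rw [← Nat.cast_smul_eq_nsmul ℚ, smul_smul, mul_inv_cancel₀ (by exact_mod_cast hn.ne'), one_smul]

theorem isUnperforated [Module ℚ V] : IsUnperforated (FunInfinitesimal S V) := by
  rintro n x hn (h | ⟨ε, hε, h⟩)
  · rw [← Nat.cast_smul_eq_nsmul ℚ, eq_comm, smul_eq_zero] at h
    rcases h with h | rfl
    · exact absurd h (by exact_mod_cast hn.ne')
    · exact le_rfl
  · have hn' : (0 : ℝ) < n := by exact_mod_cast hn
    refine Or.inr ⟨ε / n, by positivity, fun s => ?_⟩
    have := h s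
    rw [zero_fst_apply, zero_add, nsmul_fst_apply] at this
    rw [zero_fst_apply, zero_add, div_le_iff₀ hn']
    linarith

theorem directed (x y : FunInfinitesimal S V) : ∃ z, x ≤ z ∧ y ≤ z := by
  refine ⟨((x.1 ⊔ y.1) + BoundedContinuousFunction.const S 1, (0 : V)),
    Or.inr ⟨1, one_pos, fun s => ?_⟩, Or.inr ⟨1, one_pos, fun s => ?_⟩⟩ <;>
  simp

theorem isDimensionGroup [Module ℚ V] : IsDimensionGroup (FunInfinitesimal S V) where
  directed := directed
  interpolation := hasInterpolation
  unperforated := isUnperforated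

end FunInfinitesimal

/-! ### The embedding -/

theorem IsUnperforated.isAddTorsionFree {G : Type*} [AddCommGroup G] [PartialOrder G]
    [IsOrderedAddMonoid G] (hG : IsUnperforated G) : IsAddTorsionFree G where
  nsmul_right_injective n hn a b hab := by
    have hn := Nat.pos_of_ne_zero hn
    simp only at hab
    refine le_antisymm (sub_nonneg.mp (hG n _ hn ?_)) (sub_nonneg.mp (hG n _ hn ?_)) <;>
    simp [smul_sub, hab]

/-- A torsion-free group whose strict order is uniform strict positivity on a set `S` of bounded
functionals embeds in a simple divisible dimension group. -/
theorem exists_embedding_of_functionals (G : Type u) [AddCommGroup G] [PartialOrder G]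
    [IsOrderedAddMonoid G] [IsAddTorsionFree G] (S : Type u) [Nonempty S] (φ : S → G →+ ℝ)
    (hbdd : ∀ x, ∃ C, ∀ s, |φ s x| ≤ C) (hφ : ∀ x, 0 < x ↔ ∃ ε > 0, ∀ s, ε ≤ φ s x) :
    ∃ (H : Type u) (_ : AddCommGroup H) (_ : PartialOrder H) (_ : IsOrderedAddMonoid H),
      Nontrivial H ∧ IsSimplePOGroup H ∧ IsDivisibleGroup H ∧ IsDimensionGroup H ∧
        ∃ f : G →+ H, Function.Injective f ∧ ∀ x y : G, f x ≤ f y ↔ x ≤ y := by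
  -- With the discrete topology every bounded function is continuous.
  let _ : TopologicalSpace S := ⊥
  have : DiscreteTopology S := ⟨rfl⟩
  choose C hC using hbdd
  let f : G →+ FunInfinitesimal S (DivisibleHull G) := AddMonoidHom.mk'
    (fun x => (BoundedContinuousFunction.ofNormedAddCommGroupDiscrete (fun s => φ s x) (C x) (hC x),
      DivisibleHull.coeAddMonoidHom G x))
    fun a b => FunInfinitesimal.ext (fun s => map_add (φ s) a b) (map_add _ a b)
  have hinj : Function.Injective f := fun a b hab =>
    DivisibleHull.coe_injective (congrArg Prod.snd hab)
  refine ⟨FunInfinitesimal S (DivisibleHull G), inferInstance, inferInstance, inferInstance,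
    inferInstance, FunInfinitesimal.isSimplePOGroup,
    FunInfinitesimal.isDivisibleGroup_of_module _, FunInfinitesimal.isDimensionGroup, f, hinj,
    fun x y => ?_⟩
  rw [FunInfinitesimal.le_def, hinj.eq_iff, le_iff_eq_or_lt, ← sub_pos (a := y), hφ]
  refine or_congr_right (exists_congr fun ε => and_congr_right fun _ => forall_congr' fun s => ?_)
  rw [map_sub, le_sub_iff_add_le, add_comm]
  rfl

theorem IsState.abs_apply_le {G : Type*} [AddCommGroup G] [PartialOrder G] [IsOrderedAddMonoid G]
    {u x : G} {f : G →+ ℝ} (hf : IsState u f) {m n : ℕ} (hm : x ≤ m • u) (hn : -x ≤ n • u) :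
    |f x| ≤ max m n := by
  have h1 := hf.1 _ (sub_nonneg.mpr hm)
  have h2 := hf.1 _ (sub_nonneg.mpr hn)
  simp only [map_sub, map_nsmul, map_neg, hf.2, nsmul_eq_mul, mul_one] at h1 h2
  rw [Nat.cast_max, abs_le]
  constructor
  · linarith [le_max_right (m : ℝ) n]
  · linarith [le_max_left (m : ℝ) n]

theorem corollary2p9 (G : Type u) [AddCommGroup G] [PartialOrder G] [IsOrderedAddMonoid G]
    (hsimple : IsSimplePOGroup G) (hunperf : IsUnperforated G) :
    ∃ (H : Type u) (_ : AddCommGroup H) (_ : PartialOrder H) (_ : IsOrderedAddMonoid H),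
      Nontrivial H ∧ IsSimplePOGroup H ∧ IsDivisibleGroup H ∧ IsDimensionGroup H ∧
        ∃ f : G →+ H, Function.Injective f ∧ ∀ x y : G, f x ≤ f y ↔ x ≤ y := by
  have := hunperf.isAddTorsionFree
  by_cases hpos : ∃ u : G, 0 < u
  · obtain ⟨u, hu⟩ := hpos
    have hunit := hsimple u hu
    have : Nonempty {f : G →+ ℝ // IsState u f} := by
      obtain ⟨f, hf, -⟩ := hunit.exists_state_nonpos hunperf hu (lt_irrefl (0 : G))
      exact ⟨f, hf⟩
    refine exists_embedding_of_functionals G {f : G →+ ℝ // IsState u f} Subtype.val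
      (fun x => ?_) fun x => ⟨fun hx => ?_, ?_⟩
    · obtain ⟨m, -, hm⟩ := hunit.2 x
      obtain ⟨n, -, hn⟩ := hunit.2 (-x)
      exact ⟨_, fun s => s.2.abs_apply_le hm hn⟩
    · obtain ⟨n, hn, h⟩ := (hsimple x hx).2 u
      have hn' : (0 : ℝ) < n := by exact_mod_cast hn
      refine ⟨1 / n, by positivity, fun s => ?_⟩
      have h1 := s.2.1 _ (sub_nonneg.mpr h)
      rw [map_sub, map_nsmul, s.2.2, nsmul_eq_mul] at h1
      rw [div_le_iff₀ hn']
      linarith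
    · rintro ⟨ε, hε, h⟩
      by_contra hx
      obtain ⟨f, hf, hfx⟩ := hunit.exists_state_nonpos hunperf hu hx
      linarith [h ⟨f, hf⟩]
  -- Without strictly positive elements the order is equality, and a single zero functional
  -- describes the empty strict cone.
  · refine exists_embedding_of_functionals G PUnit (fun _ => 0) (fun x => ⟨0, by simp⟩)
      fun x => ⟨fun hx => absurd ⟨x, hx⟩ hpos, ?_⟩
    rintro ⟨ε, hε, h⟩
    exact absurd (h PUnit.unit) (by simpa using hε)
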